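/- Let $p\ge 2$ be real, let $f\in C^2(\mathbb R;\mathbb R)$ be homogeneous of degree $p$, i.e. $f(su)=s^pf(u)$ for all $s>0$ and $u\in\mathbb R$, and let $F(u)=\int_0^u f(s)\,ds$. Let $\beta,c\in\mathbb R$. Then the equation $$(1-c^2)\varphi+\beta\varphi''+\varphi''''=f(\varphi)\qquad\text{on }\mathbb R$$ has no nontrivial (i.e. not almost everywhere zero) real-valued weak solution $\varphi\in H^2(\mathbb R)$ if either of the following conditions holds: (i) $c^2\ge1$ and $\beta<\dfrac{2\sqrt{(3p+5)(p-1)(c^2-1)}}{p+3}$; (ii) $F(u)\ge0$ for all $u\in\mathbb R$, $c^2\ge1$ and $\beta\ge0$. Here $\varphi$ is a weak solution if $\int_{\mathbb R}\varphi\,\bigl((1-c^2)\psi+\beta\psi''+\psi''''\bigr)\,dx=\int_{\mathbb R}f(\varphi)\,\psi\,dx$ for every $\psi\in C_c^\infty(\mathbb R)$. -/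

import Mathlib

open MeasureTheory
open scoped ContDiff SchwartzMap

noncomputable section

namespace GSBQ

/-- `f` is (positively) homogeneous of degree `p`: `f (s u) = s ^ p f u` for `s > 0`. Both
`|u| ^ p` and `|u| ^ (p - 1) * u` are of this kind. -/
def Homogeneous (f : ℝ → ℝ) (p : ℝ) : Prop :=
  ∀ s : ℝ, 0 < s → ∀ u : ℝ, f (s * u) = s ^ p * f u

/-- The primitive `F` of `f` with `F 0 = 0`. -/
def primitive (f : ℝ → ℝ) (u : ℝ) : ℝ :=
  ∫ s in (0 : ℝ)..u, f s

/-- The real function `φ` belongs to `H²(ℝ)`: it is square integrable, and the tempered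
distribution that it defines belongs to the Bessel potential space `H^{2,2}(ℝ)`. -/
def MemH2 (φ : ℝ → ℝ) : Prop :=
  ∃ h : MemLp (fun x => (φ x : ℂ)) 2 (volume : Measure ℝ),
    TemperedDistribution.MemSobolev 2 2
      ((h.toLp : Lp ℂ 2 (volume : Measure ℝ)) : 𝓢'(ℝ, ℂ))

/-- `φ` solves `(1 - c²) φ + β φ'' + φ'''' = f(φ)` in the weak sense, that is, when tested
against every smooth function with compact support. -/
def IsWeakSolution (f : ℝ → ℝ) (β c : ℝ) (φ : ℝ → ℝ) : Prop :=
  ∀ ψ : ℝ → ℝ, ContDiff ℝ ∞ ψ → HasCompactSupport ψ →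
    ∫ x, φ x * ((1 - c ^ 2) * ψ x + β * iteratedDeriv 2 ψ x + iteratedDeriv 4 ψ x) =
      ∫ x, f (φ x) * ψ x

end GSBQ

end

/-! Write `w = c² - 1` and let `A`, `B`, `C`, `P` be the integrals of `u²`, `u'²`, `u''²`, `F(u)`.
Testing the equation with `u` gives `C - βB - wA = (p+1)P`, by Euler's identity `u f(u) =
(p+1)F(u)`. Multiplying it by `2u'` gives a conserved quantity that is integrable, hence zero; its
integral is `βB - 3C - wA = 2P` (`integral_identities`). Under (i), eliminating `P` gives `(3p+5)C +
(p-1)wA = β(p+3)B`. As `B = -∫ u u''`, expanding a square bounds the left side below by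
`2√((3p+5)(p-1)w) B`, which forces `B = 0`. Under (ii), the sum of the identities expresses zero as
a sum of nonnegative terms including `2C`, so `C = 0`. In both cases `u = 0`. These computations
need four derivatives and decay. `exists_classical_solution` supplies the former;
`memLp_deriv_of_memLp_second_deriv` puts `u'''` in `L²`, so that no boundary terms survive. -/

namespace GSBQ

open Set Filter Topology
open scoped LineDeriv

/-! ### Weak derivatives on the line -/

/-- `g` is the weak derivative of `u` on the real line. -/
def HasWeakDeriv (u g : ℝ → ℝ) : Prop :=
  ∀ ψ : ℝ → ℝ, ContDiff ℝ ∞ ψ → HasCompactSupport ψ →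
    ∫ x, u x * deriv ψ x = -∫ x, g x * ψ x

theorem contDiff_infty_deriv {ψ : ℝ → ℝ} (hψ : ContDiff ℝ ∞ ψ) : ContDiff ℝ ∞ (deriv ψ) :=
  (contDiff_infty_iff_deriv.1 hψ).2

theorem integrable_mul_test {u ψ : ℝ → ℝ} (hu : LocallyIntegrable u) (hψ : Continuous ψ)
    (hs : HasCompactSupport ψ) : Integrable (fun x => u x * ψ x) := by
  simpa [smul_eq_mul, mul_comm] using hu.integrable_smul_left_of_hasCompactSupport hψ hs

theorem intervalIntegrable_of_locallyIntegrable {g : ℝ → ℝ} (hg : LocallyIntegrable g)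
    (a b : ℝ) : IntervalIntegrable g volume a b :=
  intervalIntegrable_iff.2
    ((hg.integrableOn_isCompact isCompact_uIcc).mono_set uIoc_subset_uIcc)

/-- A compactly supported function vanishes outside some interval `[-R, R]`. -/
theorem exists_eq_zero_of_hasCompactSupport {ψ : ℝ → ℝ} (hs : HasCompactSupport ψ) :
    ∃ R : ℝ, 0 < R ∧ ∀ x, R ≤ |x| → ψ x = 0 := by
  obtain ⟨R, hR, h⟩ := hs.exists_pos_le_norm
  exact ⟨R, hR, fun x hx => h x (by simpa using hx)⟩

theorem integral_eq_intervalIntegral {w : ℝ → ℝ} {R : ℝ}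
    (hw : ∀ x, R ≤ |x| → w x = 0) : ∫ x, w x = ∫ x in (-R)..R, w x := by
  refine (intervalIntegral.integral_eq_integral_of_support_subset ?_).symm
  intro x hx
  by_contra hx'
  refine hx (hw x ?_)
  by_contra hlt
  rw [not_le, abs_lt] at hlt
  exact hx' ⟨hlt.1, hlt.2.le⟩

/-- The primitive of a locally integrable function has this function as its weak derivative. -/
theorem hasWeakDeriv_intervalIntegral {g : ℝ → ℝ} (hg : LocallyIntegrable g) :
    HasWeakDeriv (fun x => ∫ t in (0 : ℝ)..x, g t) g := by
  intro ψ hψ hs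
  obtain ⟨R, hR, hzero⟩ := exists_eq_zero_of_hasCompactSupport hs
  have hd0 : ∀ x, R < |x| → deriv ψ x = 0 := by
    intro x hx
    have : ψ =ᶠ[𝓝 x] fun _ => 0 := by
      filter_upwards [(isOpen_lt continuous_const continuous_abs).mem_nhds hx] with y hy
      exact hzero y (le_of_lt hy)
    simpa using this.deriv_eq
  -- At `|x| = R` only `ψ` is known to vanish; on the larger interval `deriv ψ` also vanishes
  -- outside.
  have hR1 : 0 < R + 1 := by linarith
  have hgi : IntervalIntegrable g volume (-(R + 1)) (R + 1) :=
    intervalIntegrable_of_locallyIntegrable hg _ _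
  have hac := hgi.absolutelyContinuousOnInterval_intervalIntegral (c := 0)
    (by rw [uIcc_of_le (by linarith)]; constructor <;> linarith)
  have hψac : AbsolutelyContinuousOnInterval ψ (-(R + 1)) (R + 1) :=
    ContDiffOn.absolutelyContinuousOnInterval (hψ.of_le (by simp)).contDiffOn
  have key := hac.integral_mul_deriv_eq_deriv_mul hψac
  rw [hzero (R + 1) (by rw [abs_of_pos hR1]; linarith),
    hzero (-(R + 1)) (by rw [abs_neg, abs_of_pos hR1]; linarith)] at key
  rw [integral_eq_intervalIntegral (R := R + 1), key, integral_eq_intervalIntegral (R := R + 1)]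
  · simp only [mul_zero, sub_self, zero_sub, neg_inj]
    refine intervalIntegral.integral_congr_ae ?_
    filter_upwards [LocallyIntegrable.ae_hasDerivAt_integral hg] with x hx _
    rw [(hx 0).deriv]
  · intro x hx
    rw [hzero x (by linarith), mul_zero]
  · intro x hx
    rw [hd0 x (by linarith), mul_zero]

/-- The primitive of a test function of zero mean is a test function. -/
theorem exists_primitive_of_integral_eq_zero {χ : ℝ → ℝ} (hχ : ContDiff ℝ ∞ χ)
    (hs : HasCompactSupport χ) (h0 : ∫ x, χ x = 0) :
    ∃ ψ : ℝ → ℝ, ContDiff ℝ ∞ ψ ∧ HasCompactSupport ψ ∧ deriv ψ = χ := by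
  obtain ⟨R, hR, hzero⟩ := exists_eq_zero_of_hasCompactSupport hs
  have hd : ∀ x, HasDerivAt (fun x => ∫ t in (-R)..x, χ t) (χ x) x := fun x =>
    intervalIntegral.integral_hasDerivAt_right (hχ.continuous.intervalIntegrable _ _)
      (hχ.continuous.stronglyMeasurableAtFilter _ _) hχ.continuous.continuousAt
  have hderiv : deriv (fun x => ∫ t in (-R)..x, χ t) = χ := funext fun x => (hd x).deriv
  refine ⟨fun x => ∫ t in (-R)..x, χ t, ?_, ?_, hderiv⟩
  · refine contDiff_infty_iff_deriv.2 ⟨fun x => (hd x).differentiableAt, ?_⟩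
    rwa [hderiv]
  · refine HasCompactSupport.intro (isCompact_Icc (a := -R) (b := R)) ?_
    intro x hx
    have hx' : x < -R ∨ R < x := by
      by_contra hcon
      push Not at hcon
      exact hx ⟨hcon.1, hcon.2⟩
    rcases hx' with hx | hx
    · refine intervalIntegral.integral_zero_ae (ae_of_all _ fun t ht => hzero t ?_)
      rw [uIoc_of_ge hx.le] at ht
      rw [abs_of_nonpos (by linarith [ht.2])]
      linarith [ht.2]
    · show ∫ t in (-R)..x, χ t = 0
      rw [← intervalIntegral.integral_add_adjacent_intervals
        (hχ.continuous.intervalIntegrable (-R) R) (hχ.continuous.intervalIntegrable R x),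
        ← integral_eq_intervalIntegral hzero, h0, zero_add]
      refine intervalIntegral.integral_zero_ae (ae_of_all _ fun t ht => hzero t ?_)
      rw [uIoc_of_le hx.le] at ht
      rw [abs_of_nonneg (by linarith [ht.1])]
      exact ht.1.le

theorem exists_test_integral_eq_one :
    ∃ ρ : ℝ → ℝ, ContDiff ℝ ∞ ρ ∧ HasCompactSupport ρ ∧ ∫ x, ρ x = 1 := by
  let b : ContDiffBump (0 : ℝ) := ⟨1, 2, one_pos, one_lt_two⟩
  exact ⟨b.normed volume, b.contDiff_normed, b.hasCompactSupport_normed, b.integral_normed⟩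

/-- Subtracting a multiple of `ρ` from a test function yields the derivative of a test function. -/
theorem exists_test_deriv_eq_sub {ρ χ : ℝ → ℝ} (hρ : ContDiff ℝ ∞ ρ) (hρs : HasCompactSupport ρ)
    (hρ1 : ∫ x, ρ x = 1) (hχ : ContDiff ℝ ∞ χ) (hs : HasCompactSupport χ) :
    ∃ ψ : ℝ → ℝ, ContDiff ℝ ∞ ψ ∧ HasCompactSupport ψ ∧
      deriv ψ = fun x => χ x - (∫ y, χ y) * ρ x := by
  refine exists_primitive_of_integral_eq_zero (hχ.sub (contDiff_const.mul hρ))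
    (hs.sub hρs.mul_left) ?_
  rw [integral_sub (hχ.continuous.integrable_of_hasCompactSupport hs)
    ((hρ.continuous.integrable_of_hasCompactSupport hρs).const_mul _), integral_const_mul, hρ1]
  ring

/-- **Du Bois-Reymond's lemma**: a function whose weak derivative vanishes is constant. -/
theorem ae_eq_const_of_hasWeakDeriv_zero {u : ℝ → ℝ} (hu : LocallyIntegrable u)
    (h : HasWeakDeriv u 0) : ∃ a : ℝ, u =ᵐ[volume] fun _ => a := by
  obtain ⟨ρ, hρ, hρs, hρ1⟩ := exists_test_integral_eq_one
  -- Testing with `ψ' = χ - (∫ χ) ρ` gives `∫ u χ = (∫ u ρ)(∫ χ)`, which identifies the constant.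
  refine ⟨∫ x, u x * ρ x, ae_eq_of_integral_contDiff_smul_eq hu (locallyIntegrable_const _) ?_⟩
  intro χ hχ hs
  obtain ⟨ψ, hψ, hψs, hψd⟩ := exists_test_deriv_eq_sub hρ hρs hρ1 hχ hs
  have key := h ψ hψ hψs
  rw [hψd] at key
  simp only [mul_sub, Pi.zero_apply, zero_mul, integral_zero, neg_zero, ← mul_assoc] at key
  rw [integral_sub (integrable_mul_test hu hχ.continuous hs)] at key
  · simp only [mul_comm (u _), mul_assoc] at key
    rw [integral_const_mul] at key
    simp only [smul_eq_mul, integral_mul_const, mul_comm (u _)]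
    linarith
  · simpa only [mul_comm (u _), mul_assoc] using
      (integrable_mul_test hu hρ.continuous hρs).const_mul (∫ y, χ y)

/-- A function with a locally integrable weak derivative is a primitive of the latter. -/
theorem HasWeakDeriv.ae_eq_primitive {u g : ℝ → ℝ} (hu : LocallyIntegrable u)
    (hg : LocallyIntegrable g) (h : HasWeakDeriv u g) :
    ∃ a : ℝ, u =ᵐ[volume] fun x => a + ∫ t in (0 : ℝ)..x, g t := by
  have hc : Continuous fun x => ∫ t in (0 : ℝ)..x, g t :=
    intervalIntegral.continuous_primitive (intervalIntegrable_of_locallyIntegrable hg) 0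
  have hli := hc.locallyIntegrable (μ := volume)
  obtain ⟨a, ha⟩ := ae_eq_const_of_hasWeakDeriv_zero (hu.sub hli) (by
    intro ψ hψ hs
    have hψ' := (contDiff_infty_deriv hψ).continuous
    simp only [Pi.sub_apply, sub_mul, Pi.zero_apply, zero_mul, integral_zero, neg_zero]
    rw [integral_sub (integrable_mul_test hu hψ' hs.deriv) (integrable_mul_test hli hψ' hs.deriv),
      h ψ hψ hs, hasWeakDeriv_intervalIntegral hg ψ hψ hs, sub_self])
  refine ⟨a, ha.mono fun x hx => ?_⟩
  simp only [Pi.sub_apply] at hx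
  linarith

/-- A function whose weak second derivative is continuous is twice differentiable. -/
theorem exists_ae_eq_of_weak_second_deriv {u k : ℝ → ℝ} (hu : LocallyIntegrable u)
    (hk : Continuous k)
    (h : ∀ ψ : ℝ → ℝ, ContDiff ℝ ∞ ψ → HasCompactSupport ψ →
      ∫ x, u x * deriv (deriv ψ) x = ∫ x, k x * ψ x) :
    ∃ v v' : ℝ → ℝ, u =ᵐ[volume] v ∧ (∀ x, HasDerivAt v (v' x) x) ∧
      ∀ x, HasDerivAt v' (k x) x := by
  obtain ⟨ρ, hρ, hρs, hρ1⟩ := exists_test_integral_eq_one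
  have hKd : ∀ x, HasDerivAt (fun x => ∫ t in (0 : ℝ)..x, k t) (k x) x := fun x =>
    intervalIntegral.integral_hasDerivAt_right (hk.intervalIntegrable _ _)
      (hk.stronglyMeasurableAtFilter _ _) hk.continuousAt
  set K : ℝ → ℝ := fun x => ∫ t in (0 : ℝ)..x, k t with hK
  have hKc : Continuous K := continuous_iff_continuousAt.2 fun x => (hKd x).continuousAt
  -- If `u' = K + a` weakly, testing with `ρ` forces this value. Every other `χ` is `ψ' + (∫ χ) ρ`,
  -- and the hypothesis controls the part `ψ'`.
  set a : ℝ := -(∫ x, u x * deriv ρ x) - ∫ x, K x * ρ x with ha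
  have hw : HasWeakDeriv u (fun x => K x + a) := by
    intro χ hχ hs
    obtain ⟨ψ, hψ, hψs, hψd⟩ := exists_test_deriv_eq_sub hρ hρs hρ1 hχ hs
    have hχ' := (contDiff_infty_deriv hχ).continuous
    have hρ' := (contDiff_infty_deriv hρ).continuous
    have hdd : deriv (deriv ψ) = fun x => deriv χ x - (∫ y, χ y) * deriv ρ x := by
      rw [hψd]
      funext x
      have h1 : HasDerivAt χ (deriv χ x) x :=
        (hχ.differentiable (by simp)).differentiableAt.hasDerivAt
      have h2 : HasDerivAt ρ (deriv ρ x) x :=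
        (hρ.differentiable (by simp)).differentiableAt.hasDerivAt
      exact (h1.sub (h2.const_mul _)).deriv
    have e1 := h ψ hψ hψs
    have e2 := hasWeakDeriv_intervalIntegral hk.locallyIntegrable ψ hψ hψs
    have hsplit : ∀ (q α γ : ℝ → ℝ), LocallyIntegrable q → Continuous α → Continuous γ →
        HasCompactSupport α → HasCompactSupport γ → ∀ m : ℝ,
        ∫ x, q x * (α x - m * γ x) = (∫ x, q x * α x) - m * ∫ x, q x * γ x := by
      intro q α γ hq hα hγ hαs hγs m
      rw [← integral_const_mul, ← integral_sub (integrable_mul_test hq hα hαs)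
        ((integrable_mul_test hq hγ hγs).const_mul _)]
      exact integral_congr_ae (ae_of_all _ fun x => by ring)
    rw [hdd] at e1
    rw [hψd] at e2
    rw [hsplit u _ _ hu hχ' hρ' hs.deriv hρs.deriv] at e1
    rw [hsplit _ _ _ hKc.locallyIntegrable hχ.continuous hρ.continuous hs hρs] at e2
    have e3 : ∫ x, (K x + a) * χ x = (∫ x, K x * χ x) + a * ∫ x, χ x := by
      rw [← integral_const_mul, ← integral_add
        (integrable_mul_test hKc.locallyIntegrable hχ.continuous hs)
        ((hχ.continuous.integrable_of_hasCompactSupport hs).const_mul _)]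
      exact integral_congr_ae (ae_of_all _ fun x => by ring)
    rw [e3, ha]
    linarith
  have hc : Continuous fun x => K x + a := hKc.add continuous_const
  obtain ⟨b, hb⟩ := hw.ae_eq_primitive hu hc.locallyIntegrable
  refine ⟨_, fun x => K x + a, hb, fun x => ?_, fun x => (hKd x).add_const a⟩
  exact (intervalIntegral.integral_hasDerivAt_right (hc.intervalIntegrable _ _)
      (hc.stronglyMeasurableAtFilter _ _) hc.continuousAt).const_add b

/-! ### From weak `H²` solutions to classical ones -/

/-- If the distributional derivative of an `L²` function is represented by an `L²` function, then
the real parts are weak derivatives of each other. -/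
theorem hasWeakDeriv_re {U G : Lp ℂ 2 (volume : Measure ℝ)}
    (h : ∂_{(1 : ℝ)} (U : 𝓢'(ℝ, ℂ)) = (G : 𝓢'(ℝ, ℂ))) :
    HasWeakDeriv (fun x => (U x).re) (fun x => (G x).re) := by
  intro ψ hψ hs
  have hψc : ContDiff ℝ ∞ (fun x => (ψ x : ℂ)) := Complex.ofRealCLM.contDiff.comp hψ
  have hsc : HasCompactSupport (fun x => (ψ x : ℂ)) :=
    hs.comp_left (g := fun y : ℝ => (y : ℂ)) (by simp)
  have hU : LocallyIntegrable (U : ℝ → ℂ) := (Lp.memLp U).locallyIntegrable (by norm_num)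
  have hG : LocallyIntegrable (G : ℝ → ℂ) := (Lp.memLp G).locallyIntegrable (by norm_num)
  have key := DFunLike.congr_fun h (hsc.toSchwartzMap hψc)
  rw [TemperedDistribution.lineDerivOp_apply_apply, Lp.toTemperedDistribution_apply,
    Lp.toTemperedDistribution_apply] at key
  have hd : ∀ x, (-∂_{(1 : ℝ)} (hsc.toSchwartzMap hψc)) x = ((-deriv ψ x : ℝ) : ℂ) := by
    intro x
    have h1 : HasDerivAt ψ (deriv ψ x) x :=
      (hψ.differentiable (by simp)).differentiableAt.hasDerivAt
    have h2 : deriv (fun x => (ψ x : ℂ)) x = ((deriv ψ x : ℝ) : ℂ) := h1.ofReal_comp.deriv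
    rw [neg_apply, SchwartzMap.lineDerivOp_apply_eq_fderiv, Complex.ofReal_neg, ← h2]
    rfl
  have hψ' := (contDiff_infty_deriv hψ).continuous
  simp only [hd] at key
  have key' := congrArg Complex.re key
  rw [← RCLike.re_eq_complex_re, ← integral_re, ← integral_re] at key'
  · simp only [HasCompactSupport.toSchwartzMap_toFun] at key'
    simp at key'
    rw [integral_neg] at key'
    simp only [mul_comm (Complex.re _)]
    linarith
  · exact hG.integrable_smul_left_of_hasCompactSupport hψc.continuous hsc
  · exact hU.integrable_smul_left_of_hasCompactSupport
      (Complex.continuous_ofReal.comp hψ'.neg) (hs.deriv.neg.comp_left Complex.ofReal_zero)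

/-- A function in `H²(ℝ)` has two weak derivatives in `L²(ℝ)`. -/
theorem MemH2.exists_hasWeakDeriv {φ : ℝ → ℝ} (h : MemH2 φ) :
    MemLp φ 2 ∧ ∃ g₁ g₂ : ℝ → ℝ, MemLp g₁ 2 ∧ MemLp g₂ 2 ∧ HasWeakDeriv φ g₁ ∧
      HasWeakDeriv g₁ g₂ := by
  obtain ⟨hφ, hH⟩ := h
  -- Each derivative costs one Sobolev order, leaving orders 1 and 0; both embed in order 0, which
  -- is `L²`.
  have h1 := hH.lineDerivOp (m := (1 : ℝ))
  have h2 := h1.lineDerivOp (m := (1 : ℝ))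
  have h1' := h1.mono (s' := 0) (by norm_num)
  have h2' := h2.mono (s' := 0) (by norm_num)
  obtain ⟨G, hG⟩ := TemperedDistribution.memSobolev_zero_iff.1 h1'
  obtain ⟨K, hK⟩ := TemperedDistribution.memSobolev_zero_iff.1 h2'
  rw [hG] at hK
  refine ⟨by simpa using hφ.re, fun x => (G x).re, fun x => (K x).re, (Lp.memLp G).re,
    (Lp.memLp K).re, ?_, hasWeakDeriv_re hK⟩
  intro ψ hψ hs
  rw [← hasWeakDeriv_re hG ψ hψ hs]
  refine integral_congr_ae (hφ.coeFn_toLp.mono fun x hx => ?_)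
  simp only [hx, Complex.ofReal_re]

/-- A weak `H²` solution agrees almost everywhere with a classical solution. -/
theorem exists_classical_solution {f φ : ℝ → ℝ} {β c : ℝ} (hf : Continuous f) (hφ : MemH2 φ)
    (hsol : IsWeakSolution f β c φ) :
    ∃ u u₁ u₂ u₃ : ℝ → ℝ, φ =ᵐ[volume] u ∧ MemLp u 2 ∧ MemLp u₁ 2 ∧ MemLp u₂ 2 ∧
      (∀ x, HasDerivAt u (u₁ x) x) ∧ (∀ x, HasDerivAt u₁ (u₂ x) x) ∧
      (∀ x, HasDerivAt u₂ (u₃ x) x) ∧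
      ∀ x, HasDerivAt u₃ (f (u x) + (c ^ 2 - 1) * u x - β * u₂ x) x := by
  obtain ⟨hφL, g₁, g₂, hg₁, hg₂, hw₁, hw₂⟩ := hφ.exists_hasWeakDeriv
  have hφl := hφL.locallyIntegrable (by norm_num)
  have hg₁l := hg₁.locallyIntegrable (by norm_num)
  have hg₂l := hg₂.locallyIntegrable (by norm_num)
  obtain ⟨a₁, ha₁⟩ := hw₂.ae_eq_primitive hg₁l hg₂l
  obtain ⟨a, ha⟩ := hw₁.ae_eq_primitive hφl hg₁l
  set u₁ : ℝ → ℝ := fun x => a₁ + ∫ t in (0 : ℝ)..x, g₂ t with hu₁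
  set u : ℝ → ℝ := fun x => a + ∫ t in (0 : ℝ)..x, g₁ t with hu
  have hu₁c : Continuous u₁ := continuous_const.add
    (intervalIntegral.continuous_primitive (intervalIntegrable_of_locallyIntegrable hg₂l) 0)
  have hder : ∀ {g q : ℝ → ℝ} (b : ℝ), g =ᵐ[volume] q → Continuous q → ∀ x,
      HasDerivAt (fun x => b + ∫ t in (0 : ℝ)..x, g t) (q x) x := by
    intro g q b hgq hq x
    have : (fun x => b + ∫ t in (0 : ℝ)..x, g t) = fun x => b + ∫ t in (0 : ℝ)..x, q t := by
      funext y
      rw [intervalIntegral.integral_congr_ae (hgq.mono fun t ht _ => ht)]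
    rw [this]
    exact (intervalIntegral.integral_hasDerivAt_right (hq.intervalIntegrable _ _)
      (hq.stronglyMeasurableAtFilter _ _) hq.continuousAt).const_add b
  have hud : ∀ x, HasDerivAt u (u₁ x) x := hder a ha₁ hu₁c
  have huc : Continuous u := continuous_iff_continuousAt.2 fun x => (hud x).continuousAt
  have hkc : Continuous fun x => f (u x) + (c ^ 2 - 1) * u x := by fun_prop
  -- The equation reads `(g₂ + βφ)'' = f(u) + (c² - 1)u` weakly, with continuous right side.
  obtain ⟨v, v', hv, hvd, hv'd⟩ := exists_ae_eq_of_weak_second_deriv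
    (u := fun x => g₂ x + β * φ x) (hg₂l.add (hφl.smul β)) hkc (by
      intro ψ hψ hs
      have hψ1 := contDiff_infty_deriv hψ
      have hψ2 := contDiff_infty_deriv hψ1
      have hψ3 := contDiff_infty_deriv hψ2
      have hψ4 := contDiff_infty_deriv hψ3
      have e := hsol ψ hψ hs
      have e₁ := hw₁ _ hψ3 hs.deriv.deriv.deriv
      have e₂ := hw₂ _ hψ2 hs.deriv.deriv
      have i0 := integrable_mul_test hφl hψ.continuous hs
      have i2 := integrable_mul_test hφl hψ2.continuous hs.deriv.deriv
      have i4 := integrable_mul_test hφl hψ4.continuous hs.deriv.deriv.deriv.deriv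
      have j2 := integrable_mul_test hg₂l hψ2.continuous hs.deriv.deriv
      have k0 : Integrable fun x => f (u x) * ψ x :=
        integrable_mul_test (hf.comp huc).locallyIntegrable hψ.continuous hs
      have k1 := integrable_mul_test huc.locallyIntegrable hψ.continuous hs
      have eL : ∫ x, φ x * ((1 - c ^ 2) * ψ x + β * iteratedDeriv 2 ψ x + iteratedDeriv 4 ψ x) =
          (1 - c ^ 2) * (∫ x, φ x * ψ x) + β * (∫ x, φ x * deriv (deriv ψ) x) +
            ∫ x, φ x * deriv (deriv (deriv (deriv ψ))) x := by
        rw [← integral_const_mul, ← integral_const_mul,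
          ← integral_add (i0.const_mul _) (i2.const_mul _),
          ← integral_add ((i0.const_mul _).fun_add (i2.const_mul _)) i4]
        refine integral_congr_ae (ae_of_all _ fun x => ?_)
        simp only [iteratedDeriv_succ, iteratedDeriv_zero]
        ring
      have eR : ∫ x, f (φ x) * ψ x = ∫ x, f (u x) * ψ x :=
        integral_congr_ae (ha.mono fun x hx => by simp only [hx])
      have eU : ∫ x, φ x * ψ x = ∫ x, u x * ψ x :=
        integral_congr_ae (ha.mono fun x hx => by simp only [hx])
      have l1 : ∫ x, (g₂ x + β * φ x) * deriv (deriv ψ) x =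
          (∫ x, g₂ x * deriv (deriv ψ) x) + β * ∫ x, φ x * deriv (deriv ψ) x := by
        rw [← integral_const_mul, ← integral_add j2 (i2.const_mul _)]
        exact integral_congr_ae (ae_of_all _ fun x => by ring)
      have l2 : ∫ x, (f (u x) + (c ^ 2 - 1) * u x) * ψ x =
          (∫ x, f (u x) * ψ x) + (c ^ 2 - 1) * ∫ x, u x * ψ x := by
        rw [← integral_const_mul, ← integral_add k0 (k1.const_mul _)]
        exact integral_congr_ae (ae_of_all _ fun x => by ring)
      rw [l1, l2]
      rw [eL, eR, eU] at e
      linarith)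
  have hvc : Continuous v := continuous_iff_continuousAt.2 fun x => (hvd x).continuousAt
  have hg₂v : g₂ =ᵐ[volume] fun x => v x - β * u x := by
    filter_upwards [hv, ha] with x h1 h2
    rw [← h1, ← h2]
    ring
  refine ⟨u, u₁, fun x => v x - β * u x, fun x => v' x - β * u₁ x, ha, (memLp_congr_ae ha).1 hφL,
    (memLp_congr_ae ha₁).1 hg₁, (memLp_congr_ae hg₂v).1 hg₂, hud,
    hder a₁ hg₂v (by fun_prop), fun x => (hvd x).sub ((hud x).const_mul β), fun x => ?_⟩
  exact (hv'd x).sub ((hder a₁ hg₂v (by fun_prop) x).const_mul β)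

/-! ### Bounds and square integrability of derivatives -/

theorem integrable_mul_of_memLp_two {u v : ℝ → ℝ} (hu : MemLp u 2) (hv : MemLp v 2) :
    Integrable (fun x => u x * v x) := hu.integrable_mul hv

/-- An `H¹` function is bounded. -/
theorem exists_bound_of_memLp_deriv {u u₁ : ℝ → ℝ} (hu : MemLp u 2) (hu₁ : MemLp u₁ 2)
    (hd : ∀ x, HasDerivAt u (u₁ x) x) : ∃ R : ℝ, ∀ x, |u x| ≤ R := by
  have i1 := integrable_mul_of_memLp_two hu hu₁
  refine ⟨√(u 0 ^ 2 + 2 * ∫ x, |u x * u₁ x|), fun x => Real.abs_le_sqrt ?_⟩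
  have hsq : ∀ x, HasDerivAt (fun x => u x ^ 2) (2 * (u x * u₁ x)) x := fun x =>
    ((hd x).pow 2).congr_deriv (by push_cast; ring)
  have h1 := intervalIntegral.integral_eq_sub_of_hasDerivAt (a := 0) (b := x)
    (fun y _ => hsq y) (i1.const_mul 2).intervalIntegrable
  rw [intervalIntegral.integral_const_mul] at h1
  have h2 : |∫ y in (0 : ℝ)..x, u y * u₁ y| ≤ ∫ y, |u y * u₁ y| := by
    rw [← Real.norm_eq_abs]
    refine (intervalIntegral.norm_integral_le_integral_norm_uIoc).trans ?_
    exact setIntegral_le_integral i1.norm (ae_of_all _ fun y => norm_nonneg _)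
  have := le_abs_self (∫ y in (0 : ℝ)..x, u y * u₁ y)
  linarith

/-- If `u` and `u''` are square integrable, then so is `u'`, on the positive half-line. -/
theorem integrableOn_Ioi_deriv_sq {u u₁ u₂ : ℝ → ℝ} (hu : MemLp u 2) (hu₂ : MemLp u₂ 2)
    (hd : ∀ x, HasDerivAt u (u₁ x) x) (hd₁ : ∀ x, HasDerivAt u₁ (u₂ x) x) :
    IntegrableOn (fun x => u₁ x ^ 2) (Ioi 0) := by
  have hu₁c : Continuous u₁ := continuous_iff_continuousAt.2 fun x => (hd₁ x).continuousAt
  have huc : Continuous u := continuous_iff_continuousAt.2 fun x => (hd x).continuousAt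
  have i1 : ∀ a b, IntervalIntegrable (fun x => u₁ x ^ 2) volume a b := fun a b =>
    (hu₁c.pow 2).intervalIntegrable a b
  have i2 := integrable_mul_of_memLp_two hu hu₂
  set M : ℝ := ∫ x, |u x * u₂ x| with hM
  by_contra hnot
  -- In `u u' = u(0)u'(0) + ∫ u'² + ∫ u u''` the first term and `M` absorb the boundary value and
  -- the last integral. So `u u' ≥ 1` eventually, and `u²` grows linearly, contradicting `u ∈ L²`.
  have hlarge : ∃ R > 0, |u 0 * u₁ 0| + M + 1 < ∫ x in (0 : ℝ)..R, u₁ x ^ 2 := by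
    by_contra hcon
    push Not at hcon
    refine hnot (integrableOn_Ioi_of_intervalIntegral_norm_bounded (|u 0 * u₁ 0| + M + 1) 0
      (fun i : ℝ => ((hu₁c.pow 2).integrableOn_Icc).mono_set Ioc_subset_Icc_self) tendsto_id ?_)
    filter_upwards [eventually_gt_atTop (0 : ℝ)] with R hR
    simpa using hcon R hR
  obtain ⟨R, hR, hRl⟩ := hlarge
  have hge : ∀ x, R ≤ x → 1 ≤ u x * u₁ x := by
    intro x hx
    have hprod : ∀ y, HasDerivAt (fun y => u y * u₁ y) (u₁ y ^ 2 + u y * u₂ y) y := fun y =>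
      ((hd y).mul (hd₁ y)).congr_deriv (by ring)
    have h1 := intervalIntegral.integral_eq_sub_of_hasDerivAt (a := 0) (b := x)
      (fun y _ => hprod y)
      ((i1 _ _).add i2.intervalIntegrable)
    rw [intervalIntegral.integral_add (i1 _ _)
      i2.intervalIntegrable] at h1
    have h2 : |∫ y in (0 : ℝ)..x, u y * u₂ y| ≤ M := by
      rw [← Real.norm_eq_abs]
      refine (intervalIntegral.norm_integral_le_integral_norm_uIoc).trans ?_
      exact setIntegral_le_integral i2.norm (ae_of_all _ fun y => norm_nonneg _)
    have h3 : ∫ y in (0 : ℝ)..R, u₁ y ^ 2 ≤ ∫ y in (0 : ℝ)..x, u₁ y ^ 2 :=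
      intervalIntegral.integral_mono_interval le_rfl hR.le hx
        (ae_of_all _ fun y => sq_nonneg _) (i1 _ _)
    have h4 := neg_abs_le (∫ y in (0 : ℝ)..x, u y * u₂ y)
    have h5 := neg_abs_le (u 0 * u₁ 0)
    linarith
  have hsq : ∀ x, R ≤ x → 2 * (x - R) ≤ u x ^ 2 := by
    intro x hx
    have hder : ∀ y, HasDerivAt (fun y => u y ^ 2) (2 * (u y * u₁ y)) y := fun y =>
      ((hd y).pow 2).congr_deriv (by push_cast; ring)
    have hc : Continuous fun y => 2 * (u y * u₁ y) := by fun_prop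
    have h1 := intervalIntegral.integral_eq_sub_of_hasDerivAt (a := R) (b := x)
      (fun y _ => hder y) (hc.intervalIntegrable _ _)
    have h2 : ∫ _ in R..x, (2 : ℝ) ≤ ∫ y in R..x, 2 * (u y * u₁ y) :=
      intervalIntegral.integral_mono_on hx (by simp) (hc.intervalIntegrable _ _)
        fun y hy => by linarith [hge y hy.1]
    rw [intervalIntegral.integral_const, smul_eq_mul] at h2
    linarith [sq_nonneg (u R)]
  have hint : IntegrableOn (fun _ : ℝ => (1 : ℝ)) (Ioi (R + 1)) := by
    refine Integrable.mono' (hu.integrable_sq.integrableOn) (by fun_prop) ?_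
    refine (ae_restrict_iff' measurableSet_Ioi).2 (ae_of_all _ fun x hx => ?_)
    have hx' : R + 1 < x := hx
    have := hsq x (by linarith)
    rw [norm_one]
    linarith
  rw [integrableOn_const_iff] at hint
  simp at hint

/-- If `u` and `u''` are square integrable, then so is `u'`. -/
theorem memLp_deriv_of_memLp_second_deriv {u u₁ u₂ : ℝ → ℝ} (hu : MemLp u 2) (hu₂ : MemLp u₂ 2)
    (hd : ∀ x, HasDerivAt u (u₁ x) x) (hd₁ : ∀ x, HasDerivAt u₁ (u₂ x) x) : MemLp u₁ 2 := by
  have hu₁c : Continuous u₁ := continuous_iff_continuousAt.2 fun x => (hd₁ x).continuousAt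
  rw [memLp_two_iff_integrable_sq hu₁c.aestronglyMeasurable, ← integrableOn_univ,
    ← Iic_union_Ioi (a := (0 : ℝ))]
  refine IntegrableOn.union ?_ (integrableOn_Ioi_deriv_sq hu hu₂ hd hd₁)
  -- The negative half-line follows by reflection.
  have hneg := Measure.measurePreserving_neg (volume : Measure ℝ)
  have h := integrableOn_Ioi_deriv_sq (u := fun x => u (-x)) (u₁ := fun x => -u₁ (-x))
    (u₂ := fun x => u₂ (-x)) (hu.comp_measurePreserving hneg) (hu₂.comp_measurePreserving hneg)
    (fun x => ((hd (-x)).comp x (hasDerivAt_neg x)).congr_deriv (by ring))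
    (fun x => ((hd₁ (-x)).comp x (hasDerivAt_neg x)).neg.congr_deriv (by ring))
  simp only [neg_sq] at h
  have h' := (integrableOn_Ici_iff_integrableOn_Ioi).2 h
  refine (hneg.integrableOn_comp_preimage (Homeomorph.neg ℝ).measurableEmbedding
    (f := fun x => u₁ x ^ 2) (s := Iic 0)).1 ?_
  rw [show (Neg.neg : ℝ → ℝ) ⁻¹' Iic 0 = Ici 0 by ext; simp]
  exact h'

/-! ### The homogeneous nonlinearity -/

theorem Homogeneous.map_zero {f : ℝ → ℝ} {p : ℝ} (hp : 0 < p) (hom : Homogeneous f p) :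
    f 0 = 0 := by
  have h := hom 2 two_pos 0
  rw [mul_zero] at h
  have h2 : (1 : ℝ) < 2 ^ p := Real.one_lt_rpow one_lt_two hp
  nlinarith [mul_self_nonneg (f 0)]

/-- Euler's identity `u f(u) = (p + 1) F(u)` for the primitive of a homogeneous function. -/
theorem Homogeneous.mul_eq_primitive {f : ℝ → ℝ} {p : ℝ} (hp : 0 < p) (hom : Homogeneous f p)
    (u : ℝ) : u * f u = (p + 1) * primitive f u := by
  have h1 : ∫ t in (0 : ℝ)..1, f (t * u) = ∫ t in (0 : ℝ)..1, t ^ p * f u := by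
    refine intervalIntegral.integral_congr_ae (ae_of_all _ fun t ht => ?_)
    rw [uIoc_of_le zero_le_one] at ht
    exact hom t ht.1 u
  -- The substitution `s = t u` turns `F(u)` into `u ∫₀¹ f(t u) dt`.
  have h2 := intervalIntegral.mul_integral_comp_mul_right (a := 0) (b := 1) (f := f) u
  rw [intervalIntegral.integral_mul_const, integral_rpow (Or.inl (by linarith))] at h1
  rw [h1] at h2
  simp only [Real.one_rpow, zero_mul, one_mul] at h2
  rw [Real.zero_rpow (by linarith)] at h2
  rw [primitive, ← h2]
  field_simp
  ring

/-- A `C¹` function vanishing at `0` maps bounded `L²` functions to `L²`. -/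
theorem memLp_comp_of_bounded {f u : ℝ → ℝ} (hf : ContDiff ℝ 1 f) (h0 : f 0 = 0)
    (hu : MemLp u 2) (hb : ∃ R : ℝ, ∀ x, |u x| ≤ R) : MemLp (fun x => f (u x)) 2 := by
  obtain ⟨R, hR⟩ := hb
  obtain ⟨K, hK⟩ := hf.contDiffOn.exists_lipschitzOnWith one_ne_zero (convex_Icc (-R) R)
    isCompact_Icc
  refine MemLp.of_le_mul (c := K) hu
    (hf.continuous.comp_aestronglyMeasurable hu.aestronglyMeasurable) (ae_of_all _ fun x => ?_)
  have hR0 : 0 ≤ R := (abs_nonneg _).trans (hR x)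
  have := hK.dist_le_mul (u x) (abs_le.1 (hR x)) 0 ⟨by linarith, hR0⟩
  simpa [h0, dist_zero_right] using this

/-! ### Integral identities -/

/-- Integration by parts for square integrable functions with square integrable derivatives. -/
theorem integral_mul_deriv_eq_neg {u v u' v' : ℝ → ℝ} (hu : MemLp u 2) (hv : MemLp v 2)
    (hu' : MemLp u' 2) (hv' : MemLp v' 2) (hd : ∀ x, HasDerivAt u (u' x) x)
    (hd' : ∀ x, HasDerivAt v (v' x) x) : ∫ x, u x * v' x = -∫ x, u' x * v x :=
  integral_mul_deriv_eq_deriv_mul_of_integrable (fun x _ => hd x) (fun x _ => hd' x)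
    (hu.integrable_mul hv') (hu'.integrable_mul hv) (hu.integrable_mul hv)

/-- A differentiable square integrable function with zero derivative vanishes. -/
theorem eq_zero_of_integral_deriv_sq {u u₁ : ℝ → ℝ} (hu : MemLp u 2) (hu₁ : MemLp u₁ 2)
    (hu₁c : Continuous u₁) (hd : ∀ x, HasDerivAt u (u₁ x) x) (h : ∫ x, u₁ x ^ 2 ≤ 0) :
    u = 0 := by
  have h0 : ∫ x, u₁ x ^ 2 = 0 := le_antisymm h (integral_nonneg fun x => sq_nonneg _)
  rw [integral_eq_zero_iff_of_nonneg (fun x => sq_nonneg _) hu₁.integrable_sq] at h0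
  have hz : u₁ = 0 := by
    refine Continuous.ae_eq_iff_eq volume hu₁c continuous_zero |>.1 (h0.mono fun x hx => ?_)
    simpa using hx
  have hconst : ∀ x, u x = u 0 := fun x =>
    is_const_of_deriv_eq_zero (fun y => (hd y).differentiableAt)
      (fun y => by rw [(hd y).deriv, hz]; rfl) x 0
  have hcu : u = fun _ => u 0 := funext hconst
  rw [hcu] at hu
  rw [memLp_const_iff (by norm_num) (by norm_num)] at hu
  have : u 0 = 0 := by simpa using hu
  rw [hcu, this]
  rfl

/-- The two integral identities satisfied by a classical solution: testing with the solution, and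
the integrated conservation law. -/
theorem integral_identities {f u u₁ u₂ u₃ : ℝ → ℝ} {p β w : ℝ} (hp : 0 < p)
    (hf : ContDiff ℝ 1 f) (hom : Homogeneous f p)
    (hu : MemLp u 2) (hu₁ : MemLp u₁ 2) (hu₂ : MemLp u₂ 2)
    (hd : ∀ x, HasDerivAt u (u₁ x) x) (hd₁ : ∀ x, HasDerivAt u₁ (u₂ x) x)
    (hd₂ : ∀ x, HasDerivAt u₂ (u₃ x) x)
    (hd₃ : ∀ x, HasDerivAt u₃ (f (u x) + w * u x - β * u₂ x) x) :
    (∫ x, u₂ x ^ 2) - β * (∫ x, u₁ x ^ 2) - w * (∫ x, u x ^ 2) =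
        (p + 1) * ∫ x, primitive f (u x) ∧
      β * (∫ x, u₁ x ^ 2) - 3 * (∫ x, u₂ x ^ 2) - w * (∫ x, u x ^ 2) =
        2 * ∫ x, primitive f (u x) := by
  have hfu : MemLp (fun x => f (u x)) 2 :=
    memLp_comp_of_bounded hf (hom.map_zero hp) hu (exists_bound_of_memLp_deriv hu hu₁ hd)
  have hu₄ : MemLp (fun x => f (u x) + w * u x - β * u₂ x) 2 :=
    (hfu.add (hu.const_mul w)).sub (hu₂.const_mul β)
  have hu₃ : MemLp u₃ 2 := memLp_deriv_of_memLp_second_deriv hu₂ hu₄ hd₂ hd₃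
  have iP : Integrable fun x => primitive f (u x) := by
    have : (fun x => primitive f (u x)) = fun x => (p + 1)⁻¹ * (u x * f (u x)) := by
      funext x
      rw [hom.mul_eq_primitive hp]
      field_simp
    rw [this]
    exact (integrable_mul_of_memLp_two hu hfu).const_mul _
  have i0 := hu.integrable_sq
  have i1 := hu₁.integrable_sq
  have i2 := hu₂.integrable_sq
  have i02 := integrable_mul_of_memLp_two hu hu₂
  have i13 := integrable_mul_of_memLp_two hu₁ hu₃
  have p02 : ∫ x, u x * u₂ x = -∫ x, u₁ x ^ 2 := by
    simpa only [sq] using integral_mul_deriv_eq_neg hu hu₁ hu₁ hu₂ hd hd₁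
  have p13 : ∫ x, u₁ x * u₃ x = -∫ x, u₂ x ^ 2 := by
    simpa only [sq] using integral_mul_deriv_eq_neg hu₁ hu₂ hu₂ hu₃ hd₁ hd₂
  have p04 := integral_mul_deriv_eq_neg hu hu₃ hu₁ hu₄ hd hd₃
  constructor
  · have e : ∫ x, u x * (f (u x) + w * u x - β * u₂ x) =
        (p + 1) * (∫ x, primitive f (u x)) + w * (∫ x, u x ^ 2) - β * ∫ x, u x * u₂ x := by
      rw [← integral_const_mul, ← integral_const_mul, ← integral_const_mul,
        ← integral_add (iP.const_mul _) (i0.const_mul _),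
        ← integral_sub ((iP.const_mul _).fun_add (i0.const_mul _)) (i02.const_mul _)]
      refine integral_congr_ae (ae_of_all _ fun x => ?_)
      simp only [← hom.mul_eq_primitive hp]
      ring
    rw [e, p13, p02] at p04
    linarith
  -- `E' = 0` is the equation multiplied by `2u'`. A constant integrable on the whole line is zero.
  · set E : ℝ → ℝ := fun x => 2 * (u₁ x * u₃ x) - u₂ x ^ 2 + β * u₁ x ^ 2 - w * u x ^ 2 -
      2 * primitive f (u x) with hE
    have hEd : ∀ x, HasDerivAt E 0 x := by
      intro x
      have hP : HasDerivAt (primitive f) (f (u x)) (u x) :=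
        intervalIntegral.integral_hasDerivAt_right (hf.continuous.intervalIntegrable _ _)
          (hf.continuous.stronglyMeasurableAtFilter _ _) hf.continuous.continuousAt
      refine ((((((hd₁ x).mul (hd₃ x)).const_mul 2).sub ((hd₂ x).pow 2)).add
        (((hd₁ x).pow 2).const_mul β)).sub (((hd x).pow 2).const_mul w)).sub
        ((hP.comp x (hd x)).const_mul 2) |>.congr_deriv ?_
      push_cast
      ring
    have iE1 : Integrable fun x => 2 * (u₁ x * u₃ x) - u₂ x ^ 2 := (i13.const_mul 2).sub i2
    have iE2 := iE1.fun_add (i1.const_mul β)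
    have iE3 : Integrable fun x => 2 * (u₁ x * u₃ x) - u₂ x ^ 2 + β * u₁ x ^ 2 - w * u x ^ 2 :=
      iE2.sub (i0.const_mul w)
    have iE : Integrable E := iE3.sub (iP.const_mul 2)
    have hEc : E = fun _ => E 0 := funext fun x =>
      is_const_of_deriv_eq_zero (fun y => (hEd y).differentiableAt) (fun y => (hEd y).deriv) x 0
    have hE0 : E 0 = 0 := by
      rw [hEc, integrable_const_iff] at iE
      rcases iE with h | h
      · exact h
      · exact absurd h.measure_univ_lt_top (by simp)
    have hI : ∫ x, E x = 0 := by
      rw [hEc]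
      simp [hE0]
    have e : ∫ x, E x = 2 * (∫ x, u₁ x * u₃ x) - (∫ x, u₂ x ^ 2) + β * (∫ x, u₁ x ^ 2) -
        w * (∫ x, u x ^ 2) - 2 * ∫ x, primitive f (u x) := by
      rw [← integral_const_mul, ← integral_const_mul, ← integral_const_mul, ← integral_const_mul,
        ← integral_sub (i13.const_mul 2) i2, ← integral_add iE1 (i1.const_mul β),
        ← integral_sub iE2 (i0.const_mul w), ← integral_sub iE3 (iP.const_mul 2)]
    rw [hI, p13] at e
    linarith

end GSBQ

/-! ### Conclusion -/

theorem theorem2p4 (p : ℝ) (hp : 2 ≤ p) (f : ℝ → ℝ) (hf : ContDiff ℝ 2 f)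
    (hom : GSBQ.Homogeneous f p) (β c : ℝ)
    (h : (1 ≤ c ^ 2 ∧ β < 2 * √((3 * p + 5) * (p - 1) * (c ^ 2 - 1)) / (p + 3)) ∨
      ((∀ u : ℝ, 0 ≤ GSBQ.primitive f u) ∧ 1 ≤ c ^ 2 ∧ 0 ≤ β)) :
    ¬ ∃ φ : ℝ → ℝ, GSBQ.MemH2 φ ∧ ¬ (φ =ᵐ[volume] 0) ∧ GSBQ.IsWeakSolution f β c φ := by
  rintro ⟨φ, hφ, hne, hsol⟩
  obtain ⟨u, u₁, u₂, u₃, hφu, hu, hu₁, hu₂, hd, hd₁, hd₂, hd₃⟩ :=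
    GSBQ.exists_classical_solution hf.continuous hφ hsol
  obtain ⟨id₁, id₂⟩ := GSBQ.integral_identities (by linarith) (hf.of_le (by norm_num)) hom
    hu hu₁ hu₂ hd hd₁ hd₂ hd₃
  have hu₁c : Continuous u₁ := continuous_iff_continuousAt.2 fun x => (hd₁ x).continuousAt
  have hu₂c : Continuous u₂ := continuous_iff_continuousAt.2 fun x => (hd₂ x).continuousAt
  have p02 : ∫ x, u x * u₂ x = -∫ x, u₁ x ^ 2 := by
    simpa only [sq] using GSBQ.integral_mul_deriv_eq_neg hu hu₁ hu₁ hu₂ hd hd₁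
  have hA : 0 ≤ ∫ x, u x ^ 2 := integral_nonneg fun x => sq_nonneg _
  have hC : 0 ≤ ∫ x, u₂ x ^ 2 := integral_nonneg fun x => sq_nonneg _
  refine hne (hφu.trans (Filter.EventuallyEq.of_eq ?_))
  rcases h with ⟨hc, hβ⟩ | ⟨hF, hc, -⟩
  · refine GSBQ.eq_zero_of_integral_deriv_sq hu hu₁ hu₁c hd ?_
    set a : ℝ := √(3 * p + 5) with ha
    set b : ℝ := √((p - 1) * (c ^ 2 - 1)) with hb
    have ha2 : a ^ 2 = 3 * p + 5 := Real.sq_sqrt (by linarith)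
    have hb2 : b ^ 2 = (p - 1) * (c ^ 2 - 1) :=
      Real.sq_sqrt (mul_nonneg (by linarith) (by linarith))
    have hab : √((3 * p + 5) * (p - 1) * (c ^ 2 - 1)) = a * b := by
      rw [mul_assoc, Real.sqrt_mul (by linarith)]
    rw [hab, lt_div_iff₀ (by linarith)] at hβ
    -- The weights `a`, `b` match the coefficients of `C` and `(A)` in `hid`, so the cross term
    -- yields the threshold for `β`.
    have hsq : 0 ≤ ∫ x, (a * u₂ x + b * u x) ^ 2 := integral_nonneg fun x => sq_nonneg _
    have e : ∫ x, (a * u₂ x + b * u x) ^ 2 = a ^ 2 * (∫ x, u₂ x ^ 2) + b ^ 2 * (∫ x, u x ^ 2) +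
        2 * a * b * ∫ x, u x * u₂ x := by
      have i0 := hu.integrable_sq
      have i2 := hu₂.integrable_sq
      have i02 := GSBQ.integrable_mul_of_memLp_two hu hu₂
      rw [← integral_const_mul, ← integral_const_mul, ← integral_const_mul,
        ← integral_add (i2.const_mul _) (i0.const_mul _),
        ← integral_add ((i2.const_mul _).fun_add (i0.const_mul _)) (i02.const_mul _)]
      refine integral_congr_ae (ae_of_all _ fun x => ?_)
      ring
    rw [e, ha2, hb2, p02] at hsq
    have hid : (3 * p + 5) * (∫ x, u₂ x ^ 2) + (p - 1) * (c ^ 2 - 1) * (∫ x, u x ^ 2) =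
        β * (p + 3) * ∫ x, u₁ x ^ 2 := by
      linear_combination 2 * id₁ - (p + 1) * id₂
    by_contra hB
    rw [not_le] at hB
    have := mul_lt_mul_of_pos_right hβ hB
    linarith
  · have hP : 0 ≤ ∫ x, GSBQ.primitive f (u x) := integral_nonneg fun x => hF _
    have hid : 2 * (c ^ 2 - 1) * (∫ x, u x ^ 2) + 2 * (∫ x, u₂ x ^ 2) +
        (p + 3) * ∫ x, GSBQ.primitive f (u x) = 0 := by
      linear_combination -id₁ - id₂
    have h1 : 0 ≤ 2 * (c ^ 2 - 1) * (∫ x, u x ^ 2) := mul_nonneg (by linarith) hA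
    have h2 : 0 ≤ (p + 3) * ∫ x, GSBQ.primitive f (u x) := mul_nonneg (by linarith) hP
    -- Going through `u''` also covers `c² = 1`, where the `u²` term carries no information.
    have hu₁0 := GSBQ.eq_zero_of_integral_deriv_sq hu₁ hu₂ hu₂c hd₁ (by linarith)
    exact GSBQ.eq_zero_of_integral_deriv_sq hu hu₁ hu₁c hd (by simp [hu₁0])
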